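/- Let $k\ge 1$, $\ell\ge 2$ and let $v=v(1)\cdots v(\ell)\in[k]^\ell$ be a pattern with exactly $d$ distinct letters, $[k]=\{1,\dots,k\}$. An occurrence of $v$ in a word $w\in[k]^n$ is a sequence $1\le j_1<\dots<j_\ell\le n$ such that, for all $p,q$, $w(j_p)<w(j_q)\iff v(p)<v(q)$ and $w(j_p)=w(j_q)\iff v(p)=v(q)$; $occ_v(w)$ is the number of occurrences. For $r\ge 0$ let $f_r^v(k,n)=\#\{w\in[k]^n: occ_v(w)=r\}$ and $g_r^v(k,n)=\sum_{j=0}^r f_j^v(k,n)$. Call words $w,w'\in[k]^*$ equivalent if for every $u\in[k]^*$ and every $m\le r$ one has $occ_v(w'u)=m\iff occ_v(wu)=m$, and let $\langle w\rangle$ be the class of $w$. The automaton $Au(v,r,k)$ has as states the classes $\langle w\rangle$ with $occ_v(w)\le r$, the initial state $\langle\epsilon\rangle$ ($\epsilon$ the empty word), and an edge labelled $a\in[k]$ from $\langle w\rangle$ to $\langle wa\rangle$ whenever both are states; all states are final. A loop is a labelled edge from a state to itself; a simple path is a finite sequence of pairwise distinct states, starting at $\langle\epsilon\rangle$, in which consecutive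 states are joined by an edge. Assume $d>1$ and let $r\ge 0$. Then the number of states with exactly $d-1$ loops on a simple path of $Au(v,r,k)$ attains a maximum; write this maximum as $M_r+1$. Then $M_r\ge 1$, and there are real constants $C_r\in(0,\infty)$ and $K_r\ge 0$ such that $$\lim_{n\to\infty}\frac{g_r^v(k,n)}{n^{M_r}(d-1)^n}=C_r\qquad\text{and}\qquad \lim_{n\to\infty}\frac{f_r^v(k,n)}{n^{M_r}(d-1)^n}=K_r .$$ -/

import Mathlib

namespace PatternWords

/-- The occurrences of the pattern `v` in the word `w`: increasing sequences of positions of `w`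
whose letters are order-isomorphic to `v`. -/
abbrev Occurrence {k ℓ : ℕ} (v : Fin ℓ → Fin k) (w : List (Fin k)) : Type :=
  {j : Fin ℓ ↪o Fin w.length // ∀ p q : Fin ℓ,
    (w.get (j p) < w.get (j q) ↔ v p < v q) ∧ (w.get (j p) = w.get (j q) ↔ v p = v q)}

/-- The number of occurrences of `v` in `w`. -/
noncomputable def occ {k ℓ : ℕ} (v : Fin ℓ → Fin k) (w : List (Fin k)) : ℕ :=
  Nat.card (Occurrence v w)

/-- The number of words of length `n` over `[k]` with exactly `r` occurrences of `v`. -/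
noncomputable def f {k ℓ : ℕ} (v : Fin ℓ → Fin k) (r n : ℕ) : ℕ :=
  Set.ncard {w : List (Fin k) | w.length = n ∧ occ v w = r}

/-- The number of words of length `n` over `[k]` with at most `r` occurrences of `v`. -/
noncomputable def g {k ℓ : ℕ} (v : Fin ℓ → Fin k) (r n : ℕ) : ℕ :=
  ∑ j ∈ Finset.range (r + 1), f v j n

/-- The number of distinct letters of `v`. -/
def numLetters {k ℓ : ℕ} (v : Fin ℓ → Fin k) : ℕ :=
  (Finset.univ.image v).card

/-- Two words are equivalent if, for every continuation `u` and every `m ≤ r`, one of them followed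
by `u` has exactly `m` occurrences of `v` iff the other one has. -/
def wordSetoid {k ℓ : ℕ} (v : Fin ℓ → Fin k) (r : ℕ) : Setoid (List (Fin k)) where
  r w' w := ∀ u : List (Fin k), ∀ m ≤ r, occ v (w' ++ u) = m ↔ occ v (w ++ u) = m
  iseqv :=
    { refl := fun _ _ _ _ => Iff.rfl
      symm := fun h u m hm => (h u m hm).symm
      trans := fun h₁ h₂ u m hm => (h₁ u m hm).trans (h₂ u m hm) }

/-- All equivalence classes of words. -/
abbrev WordClass {k ℓ : ℕ} (v : Fin ℓ → Fin k) (r : ℕ) : Type :=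
  Quotient (wordSetoid v r)

/-- The class of a word. -/
def wordClass {k ℓ : ℕ} (v : Fin ℓ → Fin k) (r : ℕ) (w : List (Fin k)) : WordClass v r :=
  Quotient.mk (wordSetoid v r) w

/-- The states of the automaton: the classes of the words with at most `r` occurrences of `v`.
Only the class of the words with more than `r` occurrences is left out. -/
abbrev State {k ℓ : ℕ} (v : Fin ℓ → Fin k) (r : ℕ) : Type :=
  {s : WordClass v r // ∃ w : List (Fin k), occ v w ≤ r ∧ wordClass v r w = s}

/-- The map `⟨w⟩ ↦ ⟨wa⟩` on classes. -/
def appendLetter {k ℓ : ℕ} (v : Fin ℓ → Fin k) (r : ℕ) (s : WordClass v r) (a : Fin k) :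
    WordClass v r :=
  Quotient.map (sa := wordSetoid v r) (sb := wordSetoid v r) (fun w => w ++ [a])
    (fun w' w h u m hm => by
      simpa only [List.append_assoc] using h ([a] ++ u) m hm) s

/-- The automaton `Au(v, r, k)`. Reading `a` leads from `⟨w⟩` to `⟨wa⟩` if that is a state, and
nowhere otherwise; the initial state is the class of the empty word; all states are final. -/
def Au {k ℓ : ℕ} (v : Fin ℓ → Fin k) (r : ℕ) : NFA (Fin k) (State v r) where
  step s a := {t | appendLetter v r s.1 a = t.1}
  start := {s | s.1 = wordClass v r []}
  accept := Set.univ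

/-- There is an edge from `s` to `t` in the graph of the automaton. -/
def Edge {k ℓ : ℕ} (v : Fin ℓ → Fin k) (r : ℕ) (s t : State v r) : Prop :=
  ∃ a : Fin k, t ∈ (Au v r).step s a

/-- The number of loops (labelled edges from `s` to itself) at the state `s`. -/
noncomputable def numLoops {k ℓ : ℕ} (v : Fin ℓ → Fin k) (r : ℕ) (s : State v r) : ℕ :=
  Set.ncard {a : Fin k | s ∈ (Au v r).step s a}

/-- A simple path: a sequence of pairwise distinct states which starts at the initial state and in
which consecutive states are joined by edges. -/
structure IsSimplePath {k ℓ : ℕ} (v : Fin ℓ → Fin k) (r : ℕ) (p : List (State v r)) : Prop where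
  start : ∃ s ∈ (Au v r).start, p.head? = some s
  chain : p.IsChain (Edge v r)
  nodup : p.Nodup

/-- The number of states on `p` with exactly `d - 1` loops, `d` the number of letters of `v`. -/
noncomputable def numFullStates {k ℓ : ℕ} (v : Fin ℓ → Fin k) (r : ℕ) (p : List (State v r)) : ℕ :=
  p.countP (fun s => numLoops v r s = numLetters v - 1)

end PatternWords

/-! Words of length `n` with at most `r` occurrences are the walks of length `n` from the initial
state, so the proof is a transfer-matrix count on a graph whose only cycles are loops.

The graph is finite because a class is determined by the numbers of embeddings of all words of
length at most `ℓ`, cut off at `r + 1` (`finite_wordClass`). It is acyclic up to loops because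
reading a letter can only raise the truncated occurrence counts of all continuations, and these
counts determine the class (`profile_injective`, `profile_le_of_edge`). No state has `d` loops: they
would carry a copy of `v` that could be read again and again (`numLoops_lt_numLetters`).

Put `D = d - 1` and let `a n` be the number of words leading to a state `t`, divided by `D ^ n`.
Then `a (n + 1) = ρ * a n + b n`, where `ρ` is the number of loops at `t` over `D` and `b` comes
from the other predecessors of `t`. If `ρ < 1`, then `a` inherits the growth of `b`; if `ρ = 1`, it
is a summation and gains one degree. By induction along the order, the growth at `t` is governed by
the maximal number of states with `D` loops on a path to `t` (`exists_isGreatest_pathCount_growth`).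
Summing over the states gives both limits. Finally `M ≥ 1`, since some path meets two states with
`D` loops (`exists_pathCount_two_le`). -/

namespace PatternWords

/-! ### Growth of solutions of first-order linear recurrences -/

open Filter Topology

/-- Nonnegative sequences contracted up to a null sequence tend to zero. -/
lemma tendsto_zero_of_le_mul_add {z ε : ℕ → ℝ} {ρ : ℝ} (hρ0 : 0 ≤ ρ) (hρ : ρ < 1)
    (hz : ∀ n, 0 ≤ z n) (hε : Tendsto ε atTop (𝓝 0))
    (h : ∀ᶠ n in atTop, z (n + 1) ≤ ρ * z n + ε n) : Tendsto z atTop (𝓝 0) := by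
  rw [Metric.tendsto_atTop]
  intro δ hδ
  have hδ' : 0 < δ / 2 * (1 - ρ) := mul_pos (by linarith) (by linarith)
  obtain ⟨N, hN⟩ := eventually_atTop.1 (h.and (hε.eventually (gt_mem_nhds hδ')))
  have key : ∀ i, z (N + i) - δ / 2 ≤ ρ ^ i * z N := by
    intro i
    induction i with
    | zero => simp; linarith
    | succ i ih =>
      obtain ⟨h1, h2⟩ := hN (N + i) (by omega)
      have h3 := mul_le_mul_of_nonneg_left ih hρ0
      rw [← add_assoc, pow_succ]
      nlinarith
  have hp : Tendsto (fun i : ℕ => ρ ^ i * z N) atTop (𝓝 0) := by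
    simpa using (tendsto_pow_atTop_nhds_zero_of_lt_one hρ0 hρ).mul_const (z N)
  obtain ⟨I, hI⟩ := eventually_atTop.1 (hp.eventually (gt_mem_nhds (half_pos hδ)))
  refine ⟨N + I, fun n hn => ?_⟩
  obtain ⟨i, rfl⟩ := Nat.exists_eq_add_of_le (show N ≤ n by omega)
  have h1 := hI i (by omega)
  have h2 := key i
  rw [Real.dist_eq, sub_zero, abs_of_nonneg (hz _)]
  linarith

lemma tendsto_cast_div_cast_succ_pow (p : ℕ) :
    Tendsto (fun n : ℕ => ((n : ℝ) / ((n : ℝ) + 1)) ^ p) atTop (𝓝 1) := by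
  simpa using (tendsto_natCast_div_add_atTop (𝕜 := ℝ) 1).pow p

/-- A linear recurrence with contraction factor `ρ < 1` preserves polynomial growth. -/
lemma tendsto_div_pow_of_contracting {a b : ℕ → ℝ} {ρ β : ℝ} {p : ℕ} (hρ0 : 0 ≤ ρ) (hρ : ρ < 1)
    (hab : ∀ n, a (n + 1) = ρ * a n + b n)
    (hb : Tendsto (fun n : ℕ => b n / (n : ℝ) ^ p) atTop (𝓝 β)) :
    Tendsto (fun n : ℕ => a n / (n : ℝ) ^ p) atTop (𝓝 (β / (1 - ρ))) := by
  set L := β / (1 - ρ) with hL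
  set q : ℕ → ℝ := fun n => ((n : ℝ) / ((n : ℝ) + 1)) ^ p with hq
  have hqt : Tendsto q atTop (𝓝 1) := tendsto_cast_div_cast_succ_pow p
  have hLβ : ρ * 1 * L + β * 1 - L = 0 := by
    have : (1 - ρ) ≠ 0 := by linarith
    rw [hL]; field_simp; ring
  have hε : Tendsto (fun n : ℕ => |ρ * q n * L + b n / (n : ℝ) ^ p * q n - L|) atTop (𝓝 0) := by
    have := ((((hqt.const_mul ρ).mul_const L).add (hb.mul hqt)).sub_const L).abs
    rwa [hLβ, abs_zero] at this
  have hz : Tendsto (fun n : ℕ => |a n / (n : ℝ) ^ p - L|) atTop (𝓝 0) := by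
    refine tendsto_zero_of_le_mul_add hρ0 hρ (fun _ => abs_nonneg _) hε ?_
    filter_upwards [eventually_ge_atTop 1] with n hn
    have hn0 : (0 : ℝ) < n := by exact_mod_cast hn
    have hq0 : 0 ≤ q n := by positivity
    have hq1 : q n ≤ 1 := pow_le_one₀ (by positivity) (by rw [div_le_one (by positivity)]; linarith)
    -- The factor `q n` converts the normalisation at `n` to that at `n + 1`. The second bracket is
    -- a null sequence because `L = ρ * L + β`.
    have e : a (n + 1) / ((n + 1 : ℕ) : ℝ) ^ p - L
        = ρ * q n * (a n / (n : ℝ) ^ p - L) + (ρ * q n * L + b n / (n : ℝ) ^ p * q n - L) := by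
      rw [hab, hq]
      push_cast
      simp only [div_pow]
      field_simp
      ring
    rw [e]
    refine (abs_add_le _ _).trans (add_le_add ?_ le_rfl)
    rw [abs_mul, abs_of_nonneg (mul_nonneg hρ0 hq0)]
    exact mul_le_mul_of_nonneg_right (mul_le_of_le_one_right hρ0 hq1) (abs_nonneg _)
  have := (tendsto_zero_iff_abs_tendsto_zero _).2 hz
  simpa using this.add_const L

/-- Induction from `(n+1)^(p+2) - n^(p+2) = (n+1) * ((n+1)^(p+1) - n^(p+1)) + n^(p+1)`. -/
lemma tendsto_succ_pow_sub_pow_div_pow (p : ℕ) :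
    Tendsto (fun n : ℕ => (((n : ℝ) + 1) ^ (p + 1) - (n : ℝ) ^ (p + 1)) / (n : ℝ) ^ p) atTop
      (𝓝 ((p : ℝ) + 1)) := by
  induction p with
  | zero => simp
  | succ p ih =>
    have h1 : Tendsto (fun n : ℕ => 1 + (1 : ℝ) / n) atTop (𝓝 (1 + 0)) :=
      tendsto_one_div_atTop_nhds_zero_nat.const_add 1
    have h2 := (h1.mul ih).add_const 1
    have e : (1 + 0) * ((p : ℝ) + 1) + 1 = ((p + 1 : ℕ) : ℝ) + 1 := by push_cast; ring
    rw [e] at h2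
    refine h2.congr' ?_
    filter_upwards [eventually_ge_atTop 1] with n hn
    have hn0 : (n : ℝ) ≠ 0 := by positivity
    field_simp
    ring

/-- Summation raises the degree of polynomial growth by one. -/
lemma tendsto_sum_range_div_pow {b : ℕ → ℝ} {β : ℝ} {p : ℕ}
    (hb : Tendsto (fun n : ℕ => b n / (n : ℝ) ^ p) atTop (𝓝 β)) :
    Tendsto (fun n : ℕ => (∑ i ∈ Finset.range n, b i) / (n : ℝ) ^ (p + 1)) atTop
      (𝓝 (β / (p + 1))) := by
  -- A Stolz–Cesàro argument: `G` telescopes to `n ^ (p + 1)`, and `b` differs from a multiple of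
  -- `G` by `o(G)`.
  set G : ℕ → ℝ := fun n => ((n : ℝ) + 1) ^ (p + 1) - (n : ℝ) ^ (p + 1) with hG
  have hGsum : ∀ n, ∑ i ∈ Finset.range n, G i = (n : ℝ) ^ (p + 1) := by
    intro n
    have := Finset.sum_range_sub (fun i : ℕ => (i : ℝ) ^ (p + 1)) n
    simpa [hG] using this
  have hGpos : ∀ n, 0 < G n := fun n =>
    sub_pos.2 (pow_lt_pow_left₀ (lt_add_one _) (Nat.cast_nonneg n) (Nat.succ_ne_zero p))
  have hGt := tendsto_succ_pow_sub_pow_div_pow p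
  have hp : (p : ℝ) + 1 ≠ 0 := by positivity
  have hquot : Tendsto (fun n => (b n - β / (p + 1) * G n) / G n) atTop (𝓝 0) := by
    have := (hb.div hGt hp).sub_const (β / (p + 1))
    rw [sub_self] at this
    refine this.congr' ?_
    filter_upwards [eventually_ge_atTop 1] with n hn
    have hn0 : (n : ℝ) ≠ 0 := by positivity
    have hg := (hGpos n).ne'
    change b n / (n : ℝ) ^ p / (G n / (n : ℝ) ^ p) - _ = _
    field_simp
  have ho : (fun n => b n - β / (p + 1) * G n) =o[atTop] G :=
    Asymptotics.isLittleO_of_tendsto (fun n hn => absurd hn (hGpos n).ne') hquot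
  have hdiv : Tendsto (fun n => ∑ i ∈ Finset.range n, G i) atTop atTop := by
    simp only [hGsum]
    exact (tendsto_pow_atTop (Nat.succ_ne_zero p)).comp tendsto_natCast_atTop_atTop
  have hs := (ho.sum_range (fun n => (hGpos n).le) hdiv).tendsto_div_nhds_zero
  have := hs.add_const (β / (p + 1))
  rw [zero_add] at this
  refine this.congr' ?_
  filter_upwards [eventually_ge_atTop 1] with n hn
  have hn0 : (n : ℝ) ≠ 0 := by positivity
  rw [Finset.sum_sub_distrib, ← Finset.mul_sum, hGsum]
  field_simp
  ring

/-- Summing the recurrence bounds `(1 - ρ)` times each partial sum of `a` by `a 0 + ∑' i, b i`. -/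
lemma summable_of_contracting {a b : ℕ → ℝ} {ρ : ℝ} (hρ : ρ < 1)
    (ha0 : ∀ n, 0 ≤ a n) (hb0 : ∀ n, 0 ≤ b n) (hab : ∀ n, a (n + 1) = ρ * a n + b n)
    (hb : Summable b) : Summable a := by
  refine summable_of_sum_range_le (c := (a 0 + ∑' i, b i) / (1 - ρ)) ha0 fun n => ?_
  rw [le_div_iff₀ (by linarith)]
  have h1 := hb.sum_le_tsum (Finset.range n) (fun i _ => hb0 i)
  have h2 := Finset.sum_range_succ a n
  rw [Finset.sum_range_succ'] at h2
  simp only [hab, Finset.sum_add_distrib, ← Finset.mul_sum] at h2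
  have := ha0 n
  linarith

/-- `a` is summable if `m = 0`, and grows like `c * n ^ (m - 1)` with `c > 0` if `m > 0`. -/
def Growth (a : ℕ → ℝ) : ℕ → Prop
  | 0 => Summable a
  | p + 1 => ∃ c : ℝ, 0 < c ∧ Tendsto (fun n : ℕ => a n / (n : ℝ) ^ p) atTop (𝓝 c)

lemma Growth.exists_tendsto {a : ℕ → ℝ} {m p : ℕ} (h : Growth a m) (hm : m ≤ p + 1) :
    ∃ c : ℝ, 0 ≤ c ∧ (m = p + 1 → 0 < c) ∧
      Tendsto (fun n : ℕ => a n / (n : ℝ) ^ p) atTop (𝓝 c) := by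
  rcases m with _ | q
  · refine ⟨0, le_rfl, by omega, ?_⟩
    have h0 : Tendsto a atTop (𝓝 0) := Summable.tendsto_atTop_zero h
    refine squeeze_zero_norm' ?_ (by simpa using h0.norm)
    filter_upwards [eventually_ge_atTop 1] with n hn
    have hn1 : (1 : ℝ) ≤ (n : ℝ) ^ p := one_le_pow₀ (by exact_mod_cast hn)
    rw [norm_div, Real.norm_of_nonneg (zero_le_one.trans hn1)]
    exact div_le_self (norm_nonneg _) hn1
  · obtain ⟨c, hc, ht⟩ := h
    rcases hm.eq_or_lt with he | hlt
    · obtain rfl : q = p := by omega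
      exact ⟨c, hc.le, fun _ => hc, ht⟩
    · refine ⟨0, le_rfl, by omega, ?_⟩
      obtain ⟨j, rfl⟩ : ∃ j, p = q + (j + 1) := ⟨p - q - 1, by omega⟩
      have h1 : Tendsto (fun n : ℕ => ((n : ℝ) ^ (j + 1))⁻¹) atTop (𝓝 0) :=
        tendsto_inv_atTop_zero.comp
          ((tendsto_pow_atTop (Nat.succ_ne_zero j)).comp tendsto_natCast_atTop_atTop)
      have h2 := ht.mul h1
      rw [mul_zero] at h2
      refine h2.congr fun n => ?_
      rw [pow_add _ q, div_mul_eq_div_div, div_eq_mul_inv _ ((n : ℝ) ^ (j + 1))]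

/-- Positive combinations of sequences grow like the largest of them. -/
lemma Growth.sum {ι : Type*} {s : Finset ι} {a : ι → ℕ → ℝ} {w : ι → ℝ} {m : ι → ℕ}
    (hw : ∀ i ∈ s, 0 < w i) (h : ∀ i ∈ s, Growth (a i) (m i)) :
    Growth (fun n => ∑ i ∈ s, w i * a i n) (s.sup m) := by
  rcases hp : s.sup m with _ | p
  · have h0 : ∀ i ∈ s, m i = 0 := fun i hi => Nat.le_zero.1 (hp ▸ Finset.le_sup hi)
    refine summable_sum fun i hi => Summable.mul_left _ ?_
    have := h i hi
    rwa [h0 i hi] at this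
  · have hle : ∀ i ∈ s, m i ≤ p + 1 := fun i hi => hp ▸ Finset.le_sup hi
    choose! c hc0 hcpos hct using fun i hi => (h i hi).exists_tendsto (hle i hi)
    have hs : s.Nonempty := by
      by_contra hne
      rw [Finset.not_nonempty_iff_eq_empty] at hne
      simp [hne] at hp
    obtain ⟨i, hi, him⟩ := Finset.exists_mem_eq_sup s hs m
    refine ⟨∑ i ∈ s, w i * c i, ?_, ?_⟩
    · exact Finset.sum_pos' (fun i hi => mul_nonneg (hw i hi).le (hc0 i hi))
        ⟨i, hi, mul_pos (hw i hi) (hcpos i hi (by omega))⟩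
    · refine (tendsto_finsetSum s fun i hi => (hct i hi).const_mul (w i)).congr fun n => ?_
      rw [Finset.sum_div]
      exact Finset.sum_congr rfl fun i _ => (mul_div_assoc _ _ _).symm

lemma Growth.of_contracting {a b : ℕ → ℝ} {ρ : ℝ} {m : ℕ} (hρ0 : 0 ≤ ρ) (hρ : ρ < 1)
    (ha0 : ∀ n, 0 ≤ a n) (hb0 : ∀ n, 0 ≤ b n) (hab : ∀ n, a (n + 1) = ρ * a n + b n)
    (hb : Growth b m) : Growth a m := by
  rcases m with _ | p
  · exact summable_of_contracting hρ ha0 hb0 hab hb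
  · obtain ⟨β, hβ, ht⟩ := hb
    exact ⟨β / (1 - ρ), div_pos hβ (by linarith), tendsto_div_pow_of_contracting hρ0 hρ hab ht⟩

/-- Here `a` is a partial sum of `b`. For `m = 0` it converges, and `hpos` makes the limit positive
even if `b` vanishes. -/
lemma Growth.of_accumulating {a b : ℕ → ℝ} {m : ℕ} (hpos : ∃ n, 0 < a n)
    (hb0 : ∀ n, 0 ≤ b n) (hab : ∀ n, a (n + 1) = a n + b n) (hb : Growth b m) :
    Growth a (m + 1) := by
  have hsum : ∀ n, a n = a 0 + ∑ i ∈ Finset.range n, b i := by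
    intro n
    induction n with
    | zero => simp
    | succ n ih => rw [hab, ih, Finset.sum_range_succ]; ring
  rcases m with _ | p
  · obtain ⟨N, hN⟩ := hpos
    have hb' : Summable b := hb
    refine ⟨a 0 + ∑' i, b i, ?_, ?_⟩
    · have h1 := hb'.sum_le_tsum (Finset.range N) (fun i _ => hb0 i)
      have h2 := hsum N
      linarith
    · simp only [pow_zero, div_one]
      exact (hb'.hasSum.tendsto_sum_nat.const_add (a 0)).congr fun n => (hsum n).symm
  · obtain ⟨β, hβ, ht⟩ := hb
    refine ⟨β / (p + 1), by positivity, ?_⟩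
    have h1 : Tendsto (fun n : ℕ => ((n : ℝ) ^ (p + 1))⁻¹) atTop (𝓝 0) :=
      tendsto_inv_atTop_zero.comp
        ((tendsto_pow_atTop (Nat.succ_ne_zero p)).comp tendsto_natCast_atTop_atTop)
    have h2 := (h1.const_mul (a 0)).add (tendsto_sum_range_div_pow ht)
    rw [mul_zero, zero_add] at h2
    refine h2.congr fun n => ?_
    rw [hsum n, add_div, div_eq_mul_inv (a 0)]

end PatternWords

/-! ### Walks in finite graphs that are acyclic up to loops -/

namespace PatternWords

open Filter Topology

/-- `PathCount e D s₀ t c` says that, in the graph with `e s t` edges from `s` to `t`, there is a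
path from `s₀` to `t` without loops on which exactly `c` vertices carry `D` loops. -/
inductive PathCount {S : Type*} (e : S → S → ℕ) (D : ℕ) (s₀ : S) : S → ℕ → Prop
  | start : PathCount e D s₀ s₀ (if e s₀ s₀ = D then 1 else 0)
  | step {s t : S} {c : ℕ} : PathCount e D s₀ s c → e s t ≠ 0 → s ≠ t →
      PathCount e D s₀ t (c + if e t t = D then 1 else 0)

/-- In a finite graph that is acyclic up to loops, with at most `D` loops at each vertex, the number
of walks from `s₀` to `t` of length `n`, divided by `D ^ n`, grows with the degree given by the
maximal number of vertices with `D` loops on a path from `s₀` to `t`. -/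
theorem exists_isGreatest_pathCount_growth {S : Type*} [Fintype S] [PartialOrder S]
    {e : S → S → ℕ} {D : ℕ} {s₀ : S} {N : ℕ → S → ℕ} (hD : 0 < D)
    (hle : ∀ s t, e s t ≠ 0 → s ≤ t) (hloop : ∀ t, e t t ≤ D)
    (hN0 : ∀ t, N 0 t ≠ 0 → t = s₀) (hN : ∀ n t, N (n + 1) t = ∑ s, e s t * N n s)
    (hreach : ∀ t, ∃ n, N n t ≠ 0) (t : S) :
    ∃ m, IsGreatest {c | PathCount e D s₀ t c} m ∧
      Growth (fun n => (N n t : ℝ) / (D : ℝ) ^ n) m := by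
  classical
  induction t using WellFoundedLT.induction with
  | ind t ih =>
  choose! m hm hgrow using ih
  set P : Finset S := Finset.univ.filter fun s => s ≠ t ∧ e s t ≠ 0 with hP
  have hlt : ∀ s ∈ P, s < t := fun s hs => by
    obtain ⟨h1, h2⟩ := (Finset.mem_filter.1 hs).2
    exact lt_of_le_of_ne (hle s t h2) h1
  have hD' : (0 : ℝ) < D := by exact_mod_cast hD
  refine ⟨P.sup m + if e t t = D then 1 else 0, ⟨?_, ?_⟩, ?_⟩
  · rcases P.eq_empty_or_nonempty with hPe | hPne
    · have hstart : ∀ n, N n t ≠ 0 → t = s₀ := by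
        intro n
        induction n with
        | zero => exact hN0 t
        | succ n ihn =>
          intro h
          rw [hN] at h
          obtain ⟨s, -, hs⟩ := Finset.exists_ne_zero_of_sum_ne_zero h
          obtain ⟨h1, h2⟩ := mul_ne_zero_iff.1 hs
          by_cases hst : s = t
          · exact ihn (hst ▸ h2)
          · have : s ∈ P := Finset.mem_filter.2 ⟨Finset.mem_univ _, hst, h1⟩
            simp [hPe] at this
      obtain ⟨n, hn⟩ := hreach t
      obtain rfl := hstart n hn
      rw [hPe, Finset.sup_empty, bot_eq_zero, zero_add]
      exact PathCount.start
    · obtain ⟨s, hs, hsm⟩ := Finset.exists_mem_eq_sup P hPne m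
      obtain ⟨h1, h2⟩ := (Finset.mem_filter.1 hs).2
      rw [hsm]
      exact PathCount.step (hm s (hlt s hs)).1 h2 h1
  · intro c hc
    cases hc with
    | start => exact Nat.le_add_left _ _
    | @step s _ c hs h1 h2 =>
      have hsP : s ∈ P := Finset.mem_filter.2 ⟨Finset.mem_univ _, h2, h1⟩
      exact Nat.add_le_add_right (((hm s (hlt s hsP)).2 hs).trans (Finset.le_sup hsP)) _
  · set a : S → ℕ → ℝ := fun s n => (N n s : ℝ) / (D : ℝ) ^ n with ha
    set b : ℕ → ℝ := fun n => ∑ s ∈ P, (e s t / D : ℝ) * a s n with hb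
    have ha0 : ∀ s n, 0 ≤ a s n := fun s n => by positivity
    have hb0 : ∀ n, 0 ≤ b n := fun n =>
      Finset.sum_nonneg fun s _ => mul_nonneg (by positivity) (ha0 s n)
    have hbg : Growth b (P.sup m) := by
      refine Growth.sum (fun s hs => ?_) fun s hs => hgrow s (hlt s hs)
      have := Nat.pos_of_ne_zero (Finset.mem_filter.1 hs).2.2
      positivity
    -- The loops at `t` are split off from the edges that arrive from smaller vertices.
    have hrec : ∀ n, a t (n + 1) = (e t t / D : ℝ) * a t n + b n := by
      intro n
      have h1 : (N (n + 1) t : ℝ) = e t t * N n t + ∑ s ∈ P, (e s t : ℝ) * N n s := by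
        rw [hN, ← Finset.add_sum_erase _ _ (Finset.mem_univ t)]
        push_cast
        congr 1
        symm
        refine Finset.sum_subset (fun s hs => ?_) fun s hs hsP => ?_
        · exact Finset.mem_erase.2 ⟨(Finset.mem_filter.1 hs).2.1, Finset.mem_univ _⟩
        · have h0 : e s t = 0 := by
            by_contra h0
            exact hsP (Finset.mem_filter.2 ⟨Finset.mem_univ _, (Finset.mem_erase.1 hs).1, h0⟩)
          simp [h0]
      simp only [ha, hb]
      rw [h1, add_div, Finset.sum_div]
      congr 1
      · rw [pow_succ', mul_div_mul_comm]
      · exact Finset.sum_congr rfl fun s _ => by rw [pow_succ', mul_div_mul_comm]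
    change Growth (a t) _
    by_cases hfull : e t t = D
    · rw [if_pos hfull]
      obtain ⟨n, hn⟩ := hreach t
      refine Growth.of_accumulating ⟨n, ?_⟩ hb0 (fun n => ?_) hbg
      · have := Nat.pos_of_ne_zero hn
        positivity
      · rw [hrec, hfull, div_self hD'.ne', one_mul]
    · rw [if_neg hfull]
      have hlt1 : (e t t / D : ℝ) < 1 := by
        rw [div_lt_one hD']
        exact_mod_cast lt_of_le_of_ne (hloop t) hfull
      exact Growth.of_contracting (by positivity) hlt1 (ha0 t) hb0 hrec hbg

end PatternWords

/-! ### Subsequence counts and finiteness of the automaton -/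

namespace PatternWords

variable {k ℓ : ℕ}

/-- The increasing sequences of positions at which the word `w` reads `y`. -/
def positions {m : ℕ} (y : Fin m → Fin k) (w : List (Fin k)) : Set (Fin m → ℕ) :=
  {j | StrictMono j ∧ ∀ p, w[j p]? = some (y p)}

/-- The words `x` and `v` are order-isomorphic. -/
def OrderIsomorphic (x v : Fin ℓ → Fin k) : Prop :=
  ∀ p q, (x p < x q ↔ v p < v q) ∧ (x p = x q ↔ v p = v q)

lemma lt_length_of_mem_positions {m : ℕ} {y : Fin m → Fin k} {w : List (Fin k)} {j : Fin m → ℕ}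
    (hj : j ∈ positions y w) (p : Fin m) : j p < w.length :=
  (List.getElem?_eq_some_iff.1 (hj.2 p)).1

lemma finite_positions {m : ℕ} (y : Fin m → Fin k) (w : List (Fin k)) :
    (positions y w).Finite := by
  refine (Set.Finite.pi (t := fun _ : Fin m => Set.Iio w.length) fun _ => Set.finite_Iio _).subset ?_
  intro j hj
  simp only [Set.mem_pi, Set.mem_Iio]
  exact fun p _ => lt_length_of_mem_positions hj p

lemma positions_subset_append {m : ℕ} (y : Fin m → Fin k) (w u : List (Fin k)) :
    positions y w ⊆ positions y (w ++ u) := fun j hj =>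
  ⟨hj.1, fun p => by rw [List.getElem?_append_left (lt_length_of_mem_positions hj p), hj.2 p]⟩

-- Occurrences are sorted by the word they spell; unlike `occ`, the count of a fixed word obeys a
-- recurrence in the last letter read.
open Classical in
lemma occ_eq_sum (v : Fin ℓ → Fin k) (w : List (Fin k)) :
    occ v w = ∑ x : {x : Fin ℓ → Fin k // OrderIsomorphic x v}, (positions x.1 w).ncard := by
  have : ∀ x : {x : Fin ℓ → Fin k // OrderIsomorphic x v}, Finite (positions x.1 w) :=
    fun x => finite_positions x.1 w
  let F : Occurrence v w → Σ x : {x : Fin ℓ → Fin k // OrderIsomorphic x v}, positions x.1 w :=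
    fun j => ⟨⟨fun p => w.get (j.1 p), j.2⟩, ⟨fun p => j.1 p,
      fun _ _ h => j.1.strictMono h, fun p => by simp⟩⟩
  have hF : Function.Bijective F := by
    constructor
    · intro j j' h
      ext p
      exact congrFun (congrArg (fun z => z.2.1) h) p
    · rintro ⟨⟨x, hx⟩, ⟨j, hj⟩⟩
      have hlt : ∀ p, j p < w.length := lt_length_of_mem_positions hj
      obtain rfl : x = fun p => w.get ⟨j p, hlt p⟩ := by
        funext p
        have := hj.2 p
        rw [List.getElem?_eq_getElem (hlt p)] at this
        simpa using this.symm
      exact ⟨⟨OrderEmbedding.ofStrictMono (fun p => ⟨j p, hlt p⟩) fun _ _ h => hj.1 h, hx⟩, rfl⟩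
  rw [occ, Nat.card_eq_of_bijective F hF, Nat.card_sigma]
  rfl

lemma occ_mono_of_sublist (v : Fin ℓ → Fin k) {w w' : List (Fin k)} (h : w.Sublist w') :
    occ v w ≤ occ v w' := by
  obtain ⟨i, hi⟩ := List.sublist_iff_exists_fin_orderEmbedding_get_eq.1 h
  refine Nat.card_le_card_of_injective
    (fun j : Occurrence v w => (⟨j.1.trans i, fun p q => ?_⟩ : Occurrence v w')) ?_
  · have := j.2 p q
    rw [hi, hi] at this
    exact this
  · intro j j' hjj
    ext p
    have := DFunLike.congr_fun (congrArg Subtype.val hjj) p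
    exact congrArg Fin.val (i.injective this)

lemma occ_lt_occ_append_ofFn {v x : Fin ℓ → Fin k} (hx : OrderIsomorphic x v) (hℓ : 0 < ℓ)
    (w : List (Fin k)) : occ v w < occ v (w ++ List.ofFn x) := by
  classical
  rw [occ_eq_sum, occ_eq_sum]
  refine Finset.sum_lt_sum
    (fun y _ => Set.ncard_le_ncard (positions_subset_append _ _ _) (finite_positions _ _))
    ⟨⟨x, hx⟩, Finset.mem_univ _, Set.ncard_lt_ncard ?_ (finite_positions _ _)⟩
  refine (Set.ssubset_iff_of_subset (positions_subset_append _ _ _)).2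
    ⟨fun p => w.length + p, ⟨fun p q hpq => by simpa using hpq, fun p => ?_⟩, fun hmem => ?_⟩
  · rw [List.getElem?_append_right (Nat.le_add_right _ _)]
    simp
  · have := lt_length_of_mem_positions hmem ⟨0, hℓ⟩
    simp at this

lemma ncard_positions_zero (y : Fin 0 → Fin k) (w : List (Fin k)) :
    (positions y w).ncard = 1 := by
  have : positions y w = {Fin.elim0} := by
    ext j
    simp only [Set.mem_singleton_iff]
    exact ⟨fun _ => Subsingleton.elim _ _, fun _ => ⟨fun p => p.elim0, fun p => p.elim0⟩⟩
  rw [this, Set.ncard_singleton]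

/-- An embedding either lies in `w` or ends at the new letter; in the latter case dropping its last
position leaves an embedding of `Fin.init y`. -/
lemma ncard_positions_append_singleton {m : ℕ} (y : Fin (m + 1) → Fin k) (w : List (Fin k))
    (a : Fin k) : (positions y (w ++ [a])).ncard =
      (positions y w).ncard + if a = y (Fin.last m) then (positions (Fin.init y) w).ncard else 0 := by
  set X : Set (Fin (m + 1) → ℕ) :=
    {j | j ∈ positions y (w ++ [a]) ∧ j (Fin.last m) = w.length} with hX
  have hunion : positions y (w ++ [a]) = positions y w ∪ X := by
    ext j
    constructor
    · intro hj
      have hlt := lt_length_of_mem_positions hj (Fin.last m)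
      rw [List.length_append, List.length_singleton] at hlt
      rcases Nat.lt_succ_iff_lt_or_eq.1 hlt with h | h
      · refine Or.inl ⟨hj.1, fun p => ?_⟩
        have hp : j p < w.length := (hj.1.monotone (Fin.le_last p)).trans_lt h
        rw [← hj.2 p, List.getElem?_append_left hp]
      · exact Or.inr ⟨hj, h⟩
    · rintro (hj | hj)
      · exact positions_subset_append _ _ _ hj
      · exact hj.1
  have hdisj : Disjoint (positions y w) X := by
    rw [Set.disjoint_left]
    intro j hj hj'
    have := lt_length_of_mem_positions hj (Fin.last m)
    exact this.ne hj'.2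
  rw [hunion, Set.ncard_union_eq hdisj (finite_positions _ _)
    ((finite_positions y (w ++ [a])).subset fun j hj => hj.1)]
  congr 1
  split_ifs with hay
  · have himg : X = (fun j : Fin m → ℕ => (Fin.snoc j w.length : Fin (m + 1) → ℕ)) ''
        positions (Fin.init y) w := by
      ext j
      constructor
      · intro hj
        have hlt : ∀ p : Fin m, j p.castSucc < w.length := fun p =>
          (hj.1.1 (Fin.castSucc_lt_last p)).trans_eq hj.2
        refine ⟨Fin.init j, ⟨fun p q hpq => hj.1.1 (by simpa using hpq), fun p => ?_⟩, ?_⟩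
        · have := hj.1.2 p.castSucc
          rwa [List.getElem?_append_left (hlt p)] at this
        · change (Fin.snoc (Fin.init j) w.length : Fin (m + 1) → ℕ) = j
          rw [← hj.2]
          exact Fin.snoc_init_self j
      · rintro ⟨i, hi, rfl⟩
        refine ⟨⟨?_, fun p => ?_⟩, by simp⟩
        · intro p q hpq
          induction q using Fin.lastCases with
          | last =>
            induction p using Fin.lastCases with
            | last => exact absurd hpq (lt_irrefl _)
            | cast p => simpa using lt_length_of_mem_positions hi p
          | cast q =>
            induction p using Fin.lastCases with
            | last => exact absurd hpq (Fin.castSucc_lt_last q).not_gt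
            | cast p => simpa using hi.1 (by simpa using hpq)
        · induction p using Fin.lastCases with
          | last => simp [hay]
          | cast p =>
            have := hi.2 p
            simp only [Fin.snoc_castSucc]
            rw [List.getElem?_append_left (lt_length_of_mem_positions hi p), this]
            rfl
    rw [himg, Set.ncard_image_of_injective]
    intro i i' h
    have := congrArg (Fin.init (α := fun _ : Fin (m + 1) => ℕ)) h
    simpa only [Fin.init_snoc] using this
  · have : X = ∅ := by
      rw [Set.eq_empty_iff_forall_notMem]
      intro j hj
      have := hj.1.2 (Fin.last m)
      rw [hj.2] at this
      simp at this
      exact hay this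
    rw [this, Set.ncard_empty]

/-- The numbers of times `w` contains the words of length at most `ℓ`, cut off at `r + 1`. -/
noncomputable def truncatedCounts (ℓ r : ℕ) (w : List (Fin k)) :
    (m : Fin (ℓ + 1)) → (Fin m → Fin k) → Fin (r + 2) :=
  fun _ y => ⟨min (r + 1) (positions y w).ncard, by omega⟩

lemma truncatedCounts_eq_iff {r : ℕ} {w w' : List (Fin k)} :
    truncatedCounts ℓ r w = truncatedCounts ℓ r w' ↔ ∀ m ≤ ℓ, ∀ y : Fin m → Fin k,
      min (r + 1) (positions y w).ncard = min (r + 1) (positions y w').ncard := by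
  constructor
  · intro h m hm y
    exact congrArg Fin.val (congrFun (congrFun h ⟨m, by omega⟩) y)
  · intro h
    funext m y
    exact Fin.ext (h m (by omega) y)

/-- The recurrence only adds counts, and addition respects the cut-off; hence equal truncated counts
are a right congruence. -/
lemma truncatedCounts_append {r : ℕ} {w w' : List (Fin k)}
    (h : truncatedCounts ℓ r w = truncatedCounts ℓ r w') (u : List (Fin k)) :
    truncatedCounts ℓ r (w ++ u) = truncatedCounts ℓ r (w' ++ u) := by
  induction u using List.reverseRecOn with
  | nil => simpa using h
  | append_singleton u a ih =>
    rw [truncatedCounts_eq_iff] at ih ⊢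
    intro m hm y
    cases m with
    | zero => rw [ncard_positions_zero, ncard_positions_zero]
    | succ m =>
      have h1 := ih (m + 1) hm y
      have h2 := ih m (by omega) (Fin.init y)
      rw [← List.append_assoc, ← List.append_assoc, ncard_positions_append_singleton,
        ncard_positions_append_singleton]
      split_ifs <;> omega

lemma min_sum_congr {ι : Type*} (s : Finset ι) (R : ℕ) {p q : ι → ℕ}
    (h : ∀ i ∈ s, min R (p i) = min R (q i)) : min R (∑ i ∈ s, p i) = min R (∑ i ∈ s, q i) := by
  classical
  induction s using Finset.induction_on with
  | empty => rfl
  | insert i s hi ih =>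
    rw [Finset.sum_insert hi, Finset.sum_insert hi]
    have h1 := h i (Finset.mem_insert_self _ _)
    have h2 := ih fun j hj => h j (Finset.mem_insert_of_mem hj)
    omega

lemma min_occ_congr (v : Fin ℓ → Fin k) {r : ℕ} {w w' : List (Fin k)}
    (h : truncatedCounts ℓ r w = truncatedCounts ℓ r w') :
    min (r + 1) (occ v w) = min (r + 1) (occ v w') := by
  classical
  rw [occ_eq_sum, occ_eq_sum]
  exact min_sum_congr _ _ fun x _ => truncatedCounts_eq_iff.1 h ℓ le_rfl x.1

/-- The cut-off at `r + 1` merges exactly the counts above `r`, which the equivalence does not see.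
-/
lemma wordClass_eq_iff {v : Fin ℓ → Fin k} {r : ℕ} {w w' : List (Fin k)} :
    wordClass v r w = wordClass v r w' ↔
      ∀ u, min (r + 1) (occ v (w ++ u)) = min (r + 1) (occ v (w' ++ u)) := by
  rw [wordClass, wordClass, Quotient.eq]
  refine forall_congr' fun u => ?_
  constructor
  · intro h
    have h1 := h (occ v (w ++ u))
    have h2 := h (occ v (w' ++ u))
    by_cases h3 : occ v (w ++ u) ≤ r
    · have := (h1 h3).1 rfl
      omega
    · by_cases h4 : occ v (w' ++ u) ≤ r
      · have := (h2 h4).2 rfl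
        omega
      · omega
  · intro h m hm
    omega

instance finite_wordClass (v : Fin ℓ → Fin k) (r : ℕ) : Finite (WordClass v r) := by
  refine Finite.of_surjective
    (fun t : Set.range (truncatedCounts (k := k) ℓ r) => wordClass v r t.2.choose) ?_
  intro s
  obtain ⟨w, rfl⟩ := Quotient.exists_rep s
  refine ⟨⟨_, w, rfl⟩, wordClass_eq_iff.2 fun u => min_occ_congr v (truncatedCounts_append ?_ u)⟩
  exact (⟨w, rfl⟩ : ∃ w', truncatedCounts ℓ r w' = truncatedCounts ℓ r w).choose_spec

/-! ### The order on states by occurrences in continuations -/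

/-- The numbers of occurrences in the continuations of a word, cut off at `r + 1`, as a function of
its class. -/
noncomputable def profile (v : Fin ℓ → Fin k) (r : ℕ) (s : WordClass v r) (u : List (Fin k)) : ℕ :=
  Quotient.lift (s := wordSetoid v r) (fun w => fun u => min (r + 1) (occ v (w ++ u)))
    (fun _ _ h => funext (wordClass_eq_iff.1 (Quotient.sound h))) s u

lemma profile_wordClass (v : Fin ℓ → Fin k) (r : ℕ) (w u : List (Fin k)) :
    profile v r (wordClass v r w) u = min (r + 1) (occ v (w ++ u)) := rfl

lemma profile_injective (v : Fin ℓ → Fin k) (r : ℕ) : Function.Injective (profile v r) := by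
  intro s t h
  obtain ⟨w, rfl⟩ := Quotient.exists_rep s
  obtain ⟨w', rfl⟩ := Quotient.exists_rep t
  exact wordClass_eq_iff.2 (congrFun h)

lemma profile_le_append (v : Fin ℓ → Fin k) (r : ℕ) (w u : List (Fin k)) :
    profile v r (wordClass v r w) ≤ profile v r (wordClass v r (w ++ u)) := by
  intro x
  rw [profile_wordClass, profile_wordClass]
  exact min_le_min le_rfl (occ_mono_of_sublist v ((List.sublist_append_left w u).append_right x))

lemma occ_le_of_append {v : Fin ℓ → Fin k} {r : ℕ} {w u : List (Fin k)}
    (h : occ v (w ++ u) ≤ r) : occ v w ≤ r :=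
  (occ_mono_of_sublist v (List.sublist_append_left w u)).trans h

lemma occ_eq_of_wordClass_eq {v : Fin ℓ → Fin k} {r : ℕ} {w w' : List (Fin k)}
    (h : wordClass v r w = wordClass v r w') (hw : occ v w ≤ r) : occ v w' = occ v w := by
  have := wordClass_eq_iff.1 h []
  simp only [List.append_nil] at this
  omega

@[simp] lemma appendLetter_wordClass (v : Fin ℓ → Fin k) (r : ℕ) (w : List (Fin k)) (a : Fin k) :
    appendLetter v r (wordClass v r w) a = wordClass v r (w ++ [a]) := rfl

lemma wordClass_append_of_loops {v : Fin ℓ → Fin k} {r : ℕ} {w u : List (Fin k)}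
    (h : ∀ a ∈ u, wordClass v r (w ++ [a]) = wordClass v r w) :
    wordClass v r (w ++ u) = wordClass v r w := by
  induction u using List.reverseRecOn with
  | nil => rw [List.append_nil]
  | append_singleton u a ih =>
    rw [← List.append_assoc, ← appendLetter_wordClass,
      ih fun b hb => h b (List.mem_append_left _ hb), appendLetter_wordClass]
    exact h a (by simp)

/-- The state of a word with at most `r` occurrences. -/
def stateOf (v : Fin ℓ → Fin k) {r : ℕ} {w : List (Fin k)} (h : occ v w ≤ r) : State v r :=
  ⟨wordClass v r w, w, h, rfl⟩

lemma exists_eq_stateOf {v : Fin ℓ → Fin k} {r : ℕ} (s : State v r) :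
    ∃ (w : List (Fin k)) (h : occ v w ≤ r), s = stateOf v h := by
  obtain ⟨_, w, h, rfl⟩ := s
  exact ⟨w, h, rfl⟩

/-- The number of edges from `s` to `t`. -/
noncomputable def edgeCount (v : Fin ℓ → Fin k) (r : ℕ) (s t : State v r) : ℕ :=
  Set.ncard {a : Fin k | t ∈ (Au v r).step s a}

lemma edgeCount_ne_zero_iff {v : Fin ℓ → Fin k} {r : ℕ} {s t : State v r} :
    edgeCount v r s t ≠ 0 ↔ Edge v r s t := by
  rw [edgeCount, Ne, Set.ncard_eq_zero (Set.toFinite _), ← Ne, ← Set.nonempty_iff_ne_empty]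
  rfl

lemma profile_le_of_edge {v : Fin ℓ → Fin k} {r : ℕ} {s t : State v r} (h : Edge v r s t) :
    profile v r s.1 ≤ profile v r t.1 := by
  obtain ⟨a, ha⟩ := h
  obtain ⟨w, hw, rfl⟩ := exists_eq_stateOf s
  exact (profile_le_append v r w [a]).trans_eq (congrArg _ ha)

end PatternWords

/-! ### Loops and states with the maximal number of them -/

namespace PatternWords

variable {k ℓ : ℕ}

lemma length_pos_of_numLetters_pos {v : Fin ℓ → Fin k} (hd : 0 < numLetters v) : 0 < ℓ := by
  obtain ⟨_, ha⟩ := Finset.card_pos.1 hd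
  obtain ⟨p, -, -⟩ := Finset.mem_image.1 ha
  exact p.pos

/-- A set with at least as many letters as `v` supports a copy of `v`. -/
lemma exists_orderIsomorphic_mem {v : Fin ℓ → Fin k} {A : Finset (Fin k)}
    (hA : numLetters v ≤ A.card) : ∃ x : Fin ℓ → Fin k, OrderIsomorphic x v ∧ ∀ p, x p ∈ A := by
  let i : Finset.univ.image v ≃o Fin (numLetters v) :=
    ((Finset.univ.image v).orderIsoOfFin rfl).symm
  have hv : ∀ p, v p ∈ Finset.univ.image v := fun p => Finset.mem_image_of_mem v (Finset.mem_univ p)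
  refine ⟨fun p => A.orderEmbOfCardLe hA (i ⟨v p, hv p⟩), fun p q => ⟨?_, ?_⟩,
    fun p => A.orderEmbOfCardLe_mem hA _⟩
  · rw [OrderEmbedding.lt_iff_lt, OrderIso.lt_iff_lt, Subtype.mk_lt_mk]
  · rw [EmbeddingLike.apply_eq_iff_eq, EmbeddingLike.apply_eq_iff_eq, Subtype.mk_eq_mk]

/-- A copy of `v` that uses only letters of `v` is `v` itself. -/
lemma eq_of_orderIsomorphic_of_mem {v x : Fin ℓ → Fin k} (hx : OrderIsomorphic x v)
    (hmem : ∀ p, x p ∈ Finset.univ.image v) : x = v := by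
  have hex : ∀ l : Finset.univ.image v, ∃ p, v p = l := fun l => by
    obtain ⟨p, -, hp⟩ := Finset.mem_image.1 l.2
    exact ⟨p, hp⟩
  choose c hc using hex
  let F : Finset.univ.image v → Finset.univ.image v := fun l => ⟨x (c l), hmem _⟩
  have hF : StrictMono F := by
    intro l l' h
    change x (c l) < x (c l')
    rw [(hx _ _).1, hc, hc]
    exact h
  funext p
  let l : Finset.univ.image v := ⟨v p, Finset.mem_image_of_mem v (Finset.mem_univ p)⟩
  have hl : x (c l) = x p := ((hx _ _).2).2 (hc l)
  -- A strictly increasing self-map of a finite linear order is the identity.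
  have h : F l = l := le_antisymm hF.apply_le hF.le_apply
  rw [← hl]
  exact congrArg Subtype.val h

/-- A word over the letters of `v` contains no `v` if its first part misses the first letter of `v`
and its second part misses some letter of `v`. -/
lemma occ_append_eq_zero {v : Fin ℓ → Fin k} (hℓ : 0 < ℓ) {b : Fin k}
    (hb : b ∈ Finset.univ.image v) {x y : List (Fin k)}
    (hx : ∀ a ∈ x, a ∈ (Finset.univ.image v).erase (v ⟨0, hℓ⟩))
    (hy : ∀ a ∈ y, a ∈ (Finset.univ.image v).erase b) : occ v (x ++ y) = 0 := by
  rw [occ, Nat.card_eq_zero]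
  refine Or.inl ⟨fun j => ?_⟩
  have hv : (fun p => (x ++ y).get (j.1 p)) = v := by
    refine eq_of_orderIsomorphic_of_mem j.2 fun p => ?_
    rcases List.mem_append.1 ((x ++ y).get_mem (j.1 p)) with h | h
    · exact Finset.mem_of_mem_erase (hx _ h)
    · exact Finset.mem_of_mem_erase (hy _ h)
  -- The first letter of `v` is missing from `x`, so the whole occurrence lies in `y`, which lacks
  -- `b`.
  have h0 : x.length ≤ j.1 ⟨0, hℓ⟩ := by
    by_contra! hlt
    have h1 := congrFun hv ⟨0, hℓ⟩
    rw [List.get_eq_getElem, List.getElem_append_left hlt] at h1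
    exact Finset.ne_of_mem_erase (hx _ (List.getElem_mem hlt)) h1
  obtain ⟨p, -, rfl⟩ := Finset.mem_image.1 hb
  have hp : x.length ≤ j.1 p :=
    h0.trans (j.1.monotone (show (⟨0, hℓ⟩ : Fin ℓ) ≤ p from Nat.zero_le _))
  have h1 := congrFun hv p
  have h2 : (x ++ y).get (j.1 p) ∈ y := by
    rw [List.get_eq_getElem, List.getElem_append_right hp]
    exact List.getElem_mem _
  exact Finset.ne_of_mem_erase (hy _ h2) h1

/-- As many loops as letters of `v` would spell a copy of `v`. Reading it `r + 1` times stays in the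
same class but creates more than `r` occurrences. -/
lemma numLoops_lt_numLetters {v : Fin ℓ → Fin k} (hℓ : 0 < ℓ) {r : ℕ} (s : State v r) :
    numLoops v r s < numLetters v := by
  classical
  by_contra! h
  obtain ⟨w, hw, rfl⟩ := exists_eq_stateOf s
  rw [numLoops, Set.ncard_eq_toFinset_card'] at h
  obtain ⟨x, hx, hmem⟩ := exists_orderIsomorphic_mem h
  have hloop : ∀ p, wordClass v r (w ++ [x p]) = wordClass v r w := fun p => by
    have := hmem p
    rw [Set.mem_toFinset] at this
    exact this
  have key : ∀ i ≤ r + 1, ∃ u : List (Fin k), (∀ a ∈ u, ∃ p, x p = a) ∧ i ≤ occ v (w ++ u) := by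
    intro i
    induction i with
    | zero => exact fun _ => ⟨[], by simp, Nat.zero_le _⟩
    | succ i ih =>
      intro hi
      obtain ⟨u, hu, hiu⟩ := ih (by omega)
      refine ⟨u ++ List.ofFn x, fun a ha => ?_, ?_⟩
      · rcases List.mem_append.1 ha with ha | ha
        · exact hu a ha
        · simpa [List.mem_ofFn] using ha
      · rw [← List.append_assoc]
        exact hiu.trans_lt (occ_lt_occ_append_ofFn hx hℓ _)
  obtain ⟨u, hu, hru⟩ := key (r + 1) le_rfl
  have hcls : wordClass v r (w ++ u) = wordClass v r w :=
    wordClass_append_of_loops fun a ha => by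
      obtain ⟨p, rfl⟩ := hu a ha
      exact hloop p
  have := occ_eq_of_wordClass_eq hcls.symm hw
  omega

/-- Appending letters of `A` to a word eventually leads to a class with loops at all of `A`. -/
lemma exists_append_loops (v : Fin ℓ → Fin k) (r : ℕ) (w : List (Fin k)) (A : Finset (Fin k)) :
    ∃ u : List (Fin k), (∀ a ∈ u, a ∈ A) ∧
      ∀ a ∈ A, wordClass v r (w ++ u ++ [a]) = wordClass v r (w ++ u) := by
  let X : Set (WordClass v r) :=
    {s | ∃ u : List (Fin k), (∀ a ∈ u, a ∈ A) ∧ wordClass v r (w ++ u) = s}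
  -- Among the finitely many classes reachable with letters of `A`, one of maximal profile cannot be
  -- left by such a letter.
  obtain ⟨_, ⟨_, ⟨u, hu, rfl⟩, rfl⟩, hmax⟩ :=
    ((Set.toFinite X).image (profile v r)).exists_maximal
      ⟨_, _, ⟨[], by simp, rfl⟩, rfl⟩
  refine ⟨u, hu, fun a ha => profile_injective v r
    (le_antisymm (hmax ⟨_, ⟨u ++ [a], ?_, rfl⟩, ?_⟩ ?_) ?_)⟩
  · simpa [or_imp, forall_and, ha] using hu
  · rw [List.append_assoc]
  · exact profile_le_append v r _ _
  · exact profile_le_append v r _ _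

lemma loops_eq_of_subset {v : Fin ℓ → Fin k} (hℓ : 0 < ℓ) {r : ℕ} {w : List (Fin k)}
    (hw : occ v w ≤ r) {A : Finset (Fin k)} (hA : A.card = numLetters v - 1)
    (hloop : ∀ a ∈ A, wordClass v r (w ++ [a]) = wordClass v r w) :
    {a : Fin k | stateOf v hw ∈ (Au v r).step (stateOf v hw) a} = A := by
  symm
  refine Set.eq_of_subset_of_ncard_le (fun a ha => hloop a ha) ?_
  rw [Set.ncard_coe_finset, hA]
  exact Nat.le_sub_one_of_lt (numLoops_lt_numLetters hℓ (stateOf v hw))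

/-- Paths can be prolonged along words. -/
lemma PathCount.append {v : Fin ℓ → Fin k} {r D c : ℕ} {s₀ : State v r} {w : List (Fin k)}
    {hw : occ v w ≤ r} (h : PathCount (edgeCount v r) D s₀ (stateOf v hw) c) (u : List (Fin k))
    (hu : occ v (w ++ u) ≤ r) :
    ∃ c', PathCount (edgeCount v r) D s₀ (stateOf v hu) c' ∧ c ≤ c' ∧
      (stateOf v hu ≠ stateOf v hw → edgeCount v r (stateOf v hu) (stateOf v hu) = D →
        c + 1 ≤ c') := by
  induction u using List.reverseRecOn with
  | nil =>
    have e : stateOf v hu = stateOf v hw := Subtype.ext (by simp [stateOf])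
    exact ⟨c, e ▸ h, le_rfl, fun h' => absurd e h'⟩
  | append_singleton u a ih =>
    have hu' : occ v (w ++ u) ≤ r := by
      rw [← List.append_assoc] at hu
      exact occ_le_of_append hu
    obtain ⟨c', hc', hle, hfull⟩ := ih hu'
    by_cases he : stateOf v hu = stateOf v hu'
    · rw [he]
      exact ⟨c', hc', hle, hfull⟩
    · refine ⟨_, hc'.step (edgeCount_ne_zero_iff.2 ⟨a, ?_⟩) (Ne.symm he), ?_, fun _ hf => ?_⟩
      · change wordClass v r (w ++ u ++ [a]) = wordClass v r (w ++ (u ++ [a]))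
        rw [List.append_assoc]
      · omega
      · rw [if_pos hf]
        omega

lemma occ_nil {v : Fin ℓ → Fin k} (hℓ : 0 < ℓ) : occ v [] = 0 := by
  simpa using occ_append_eq_zero hℓ (x := []) (y := [])
    (Finset.mem_image_of_mem v (Finset.mem_univ ⟨0, hℓ⟩)) (by simp) (by simp)

/-- Some path meets two states with the maximal number of loops. -/
lemma exists_pathCount_two_le {v : Fin ℓ → Fin k} (hd : 1 < numLetters v) {r : ℕ}
    (h0 : occ v [] ≤ r) : ∃ t c, 2 ≤ c ∧
      PathCount (edgeCount v r) (numLetters v - 1) (stateOf v h0) t c := by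
  have hℓ := length_pos_of_numLetters_pos (zero_lt_one.trans hd)
  set α := v ⟨0, hℓ⟩
  have hα : α ∈ Finset.univ.image v := Finset.mem_image_of_mem v (Finset.mem_univ _)
  obtain ⟨β, hβ, hαβ⟩ := Finset.exists_mem_ne hd α
  -- The word `x` leads to loops at all letters of `v` but `α`, and `y` then to loops at all but
  -- `β`. Nothing occurs in `x ++ y`, and the different loop sets separate the two states.
  obtain ⟨x, hx, hxloop⟩ := exists_append_loops v r [] ((Finset.univ.image v).erase α)
  obtain ⟨y, hy, hyloop⟩ := exists_append_loops v r ([] ++ x) ((Finset.univ.image v).erase β)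
  have hocc : occ v ([] ++ x ++ y) ≤ r := by
    rw [List.nil_append, occ_append_eq_zero hℓ hβ hx hy]
    exact Nat.zero_le _
  have hoccx : occ v ([] ++ x) ≤ r := occ_le_of_append hocc
  have hA := loops_eq_of_subset hℓ hoccx (Finset.card_erase_of_mem hα) hxloop
  have hB := loops_eq_of_subset hℓ hocc (Finset.card_erase_of_mem hβ) hyloop
  have hfullA : edgeCount v r (stateOf v hoccx) (stateOf v hoccx) = numLetters v - 1 := by
    rw [edgeCount, hA, Set.ncard_coe_finset, Finset.card_erase_of_mem hα]
    rfl
  have hfullB : edgeCount v r (stateOf v hocc) (stateOf v hocc) = numLetters v - 1 := by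
    rw [edgeCount, hB, Set.ncard_coe_finset, Finset.card_erase_of_mem hβ]
    rfl
  have hne : stateOf v hocc ≠ stateOf v hoccx := by
    intro he
    rw [he, hA, Finset.coe_inj] at hB
    have : β ∈ (Finset.univ.image v).erase α := Finset.mem_erase.2 ⟨hαβ, hβ⟩
    rw [hB] at this
    exact Finset.notMem_erase _ _ this
  have hA1 : ∃ c, 1 ≤ c ∧
      PathCount (edgeCount v r) (numLetters v - 1) (stateOf v h0) (stateOf v hoccx) c := by
    obtain ⟨c, hc, hle, hc1⟩ := (PathCount.start (e := edgeCount v r) (D := numLetters v - 1)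
      (s₀ := stateOf v h0)).append x hoccx
    by_cases he : stateOf v hoccx = stateOf v h0
    · rw [he] at hfullA
      rw [if_pos hfullA] at hle
      exact ⟨c, hle, hc⟩
    · exact ⟨c, (Nat.le_add_left _ _).trans (hc1 he hfullA), hc⟩
  obtain ⟨c, h1c, hc⟩ := hA1
  obtain ⟨c', hc', -, hlt⟩ := hc.append y hocc
  exact ⟨_, c', (Nat.succ_le_succ h1c).trans (hlt hne hfullB), hc'⟩

/-! ### Simple paths and `PathCount` -/

lemma numFullStates_append_singleton (v : Fin ℓ → Fin k) (r : ℕ) (p : List (State v r))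
    (t : State v r) : numFullStates v r (p ++ [t]) =
      numFullStates v r p + if edgeCount v r t t = numLetters v - 1 then 1 else 0 := by
  rw [numFullStates, numFullStates, List.countP_append, List.countP_singleton]
  simp only [decide_eq_true_eq]
  rfl

lemma PathCount.of_isSimplePath {v : Fin ℓ → Fin k} {r : ℕ} (h0 : occ v [] ≤ r)
    (p : List (State v r)) (t : State v r) (hp : IsSimplePath v r (p ++ [t])) :
    PathCount (edgeCount v r) (numLetters v - 1) (stateOf v h0) t
      (numFullStates v r (p ++ [t])) := by
  induction p using List.reverseRecOn generalizing t with
  | nil =>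
    obtain ⟨s, hs, hhead⟩ := hp.start
    obtain rfl : t = s := by simpa using hhead
    obtain rfl : t = stateOf v h0 := Subtype.ext hs
    rw [numFullStates_append_singleton, numFullStates, List.countP_nil, zero_add]
    exact PathCount.start
  | append_singleton p s ih =>
    obtain ⟨h1, -, h2⟩ := List.isChain_append.1 hp.chain
    have hnd := List.nodup_append.1 hp.nodup
    rw [numFullStates_append_singleton]
    refine (ih s ⟨?_, h1, hnd.1⟩).step
      (edgeCount_ne_zero_iff.2 (h2 s (by simp) t (by simp))) (hnd.2.2 s (by simp) t (by simp))
    obtain ⟨s', hs', hhead⟩ := hp.start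
    refine ⟨s', hs', ?_⟩
    rwa [List.head?_append_of_ne_nil _ (by simp)] at hhead

/-- The profile bound on the visited states strengthens the induction: a repeated state would force
equal profiles across a proper edge. -/
lemma PathCount.exists_isSimplePath {v : Fin ℓ → Fin k} {r c : ℕ} {h0 : occ v [] ≤ r}
    {t : State v r}
    (h : PathCount (edgeCount v r) (numLetters v - 1) (stateOf v h0) t c) :
    ∃ p : List (State v r), IsSimplePath v r (p ++ [t]) ∧ numFullStates v r (p ++ [t]) = c ∧
      ∀ s ∈ p ++ [t], profile v r s.1 ≤ profile v r t.1 := by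
  induction h with
  | start =>
    refine ⟨[], ⟨⟨_, rfl, rfl⟩, by simp, by simp⟩, ?_, by simp⟩
    rw [numFullStates_append_singleton, numFullStates, List.countP_nil, zero_add]
  | @step s t c _ he hne ih =>
    obtain ⟨p, hp, hc, hle⟩ := ih
    have hedge := edgeCount_ne_zero_iff.1 he
    have hst := profile_le_of_edge hedge
    refine ⟨p ++ [s], ⟨?_, ?_, ?_⟩, ?_, ?_⟩
    · obtain ⟨s', hs', hhead⟩ := hp.start
      refine ⟨s', hs', ?_⟩
      rwa [List.head?_append_of_ne_nil _ (by simp)]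
    · refine List.isChain_append.2 ⟨hp.chain, by simp, ?_⟩
      simpa using hedge
    · refine List.nodup_append.2 ⟨hp.nodup, by simp, ?_⟩
      intro a ha b hb hab
      obtain rfl : b = t := by simpa using hb
      subst hab
      exact hne (Subtype.ext (profile_injective v r (le_antisymm hst (hle a ha))))
    · rw [numFullStates_append_singleton, hc]
    · intro a ha
      rcases List.mem_append.1 ha with ha | ha
      · exact (hle a ha).trans hst
      · obtain rfl : a = t := by simpa using ha
        exact le_rfl

/-! ### Counting words by the state they reach -/

/-- The number of words of length `n` that lead to the state `t`. -/
noncomputable def wordCount (v : Fin ℓ → Fin k) (r n : ℕ) (t : State v r) : ℕ :=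
  Nat.card {w : List (Fin k) // w.length = n ∧ wordClass v r w = t.1}

lemma finite_words (n : ℕ) (P : List (Fin k) → Prop) :
    Finite {w : List (Fin k) // w.length = n ∧ P w} :=
  ((List.finite_length_eq (Fin k) n).subset fun _ h => h.1 : {w | w.length = n ∧ P w}.Finite)

lemma eq_start_of_wordCount_zero_ne_zero {v : Fin ℓ → Fin k} {r : ℕ} (h0 : occ v [] ≤ r)
    (t : State v r) (h : wordCount v r 0 t ≠ 0) : t = stateOf v h0 := by
  obtain ⟨⟨w, hw, ht⟩⟩ := (Nat.card_ne_zero.1 h).1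
  obtain rfl := List.length_eq_zero_iff.1 hw
  exact Subtype.ext ht.symm

lemma exists_wordCount_ne_zero {v : Fin ℓ → Fin k} {r : ℕ} (t : State v r) :
    ∃ n, wordCount v r n t ≠ 0 := by
  obtain ⟨w, hw, rfl⟩ := exists_eq_stateOf t
  exact ⟨w.length, Nat.card_ne_zero.2 ⟨⟨w, rfl, rfl⟩, finite_words _ _⟩⟩

lemma wordCount_succ {v : Fin ℓ → Fin k} {r : ℕ} [Fintype (State v r)] (n : ℕ) (t : State v r) :
    wordCount v r (n + 1) t = ∑ s, edgeCount v r s t * wordCount v r n s := by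
  have := fun s : State v r => finite_words n fun w => wordClass v r w = s.1
  let F : (Σ s : State v r, {a : Fin k // t ∈ (Au v r).step s a} ×
      {w : List (Fin k) // w.length = n ∧ wordClass v r w = s.1}) →
      {w : List (Fin k) // w.length = n + 1 ∧ wordClass v r w = t.1} := fun z =>
    ⟨z.2.2.1 ++ [z.2.1.1], by simp [z.2.2.2.1], by
      rw [← appendLetter_wordClass, z.2.2.2.2]
      exact z.2.1.2⟩
  have hF : Function.Bijective F := by
    constructor
    · rintro ⟨s, ⟨a, ha⟩, ⟨w, hwn, hws⟩⟩ ⟨s', ⟨a', ha'⟩, ⟨w', hwn', hws'⟩⟩ h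
      obtain ⟨rfl, h2⟩ := List.append_inj' (congrArg Subtype.val h) rfl
      obtain rfl : a = a' := by simpa using h2
      obtain rfl : s = s' := Subtype.ext (hws.symm.trans hws')
      rfl
    · rintro ⟨w, hwn, hwt⟩
      obtain ⟨u, a, rfl⟩ : ∃ u a, w = u ++ [a] := by
        rcases List.eq_nil_or_concat w with rfl | ⟨u, a, h⟩
        · simp at hwn
        · exact ⟨u, a, by simpa using h⟩
      -- Occurrence counts up to `r` are class invariants, and prefixes have no more occurrences, so
      -- `u` also leads to a state.
      have hocc : occ v (u ++ [a]) ≤ r := by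
        obtain ⟨w', hw', rfl⟩ := exists_eq_stateOf t
        exact (occ_eq_of_wordClass_eq hwt.symm hw').trans_le hw'
      exact ⟨⟨stateOf v (occ_le_of_append hocc), ⟨a, hwt⟩, ⟨u, by simpa using hwn, rfl⟩⟩, rfl⟩
  rw [wordCount, ← Nat.card_eq_of_bijective F hF, Nat.card_sigma]
  refine Finset.sum_congr rfl fun s _ => ?_
  rw [Nat.card_prod]
  rfl

open Classical in
lemma f_eq_sum {v : Fin ℓ → Fin k} {r : ℕ} [Fintype (State v r)] {j : ℕ} (hj : j ≤ r) (n : ℕ) :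
    f v j n = ∑ t : State v r with profile v r t.1 [] = j, wordCount v r n t := by
  have := fun t : {t : State v r // profile v r t.1 [] = j} =>
    finite_words n fun w => wordClass v r w = t.1.1
  have hprof : ∀ w, profile v r (wordClass v r w) [] = min (r + 1) (occ v w) := fun w => by
    rw [profile_wordClass, List.append_nil]
  let F : (Σ t : {t : State v r // profile v r t.1 [] = j},
      {w : List (Fin k) // w.length = n ∧ wordClass v r w = t.1.1}) →
      {w : List (Fin k) | w.length = n ∧ occ v w = j} := fun z =>
    ⟨z.2.1, z.2.2.1, by
      have h1 := z.1.2
      have h2 := hprof z.2.1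
      rw [← z.2.2.2] at h1
      omega⟩
  have hF : Function.Bijective F := by
    constructor
    · rintro ⟨⟨s, hs⟩, ⟨w, hwn, hws⟩⟩ ⟨⟨s', hs'⟩, ⟨w', hwn', hws'⟩⟩ h
      obtain rfl : w = w' := congrArg Subtype.val h
      obtain rfl : s = s' := Subtype.ext (hws.symm.trans hws')
      rfl
    · rintro ⟨w, hwn, hwj⟩
      refine ⟨⟨⟨stateOf v (hwj.trans_le hj), ?_⟩, ⟨w, hwn, rfl⟩⟩, rfl⟩
      have h2 := hprof w
      change profile v r (wordClass v r w) [] = j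
      omega
  rw [f, ← Nat.card_coe_set_eq, ← Nat.card_eq_of_bijective F hF, Nat.card_sigma]
  rw [Finset.sum_subtype (p := fun t : State v r => profile v r t.1 [] = j) _ (by simp)]
  rfl

lemma g_eq_sum (v : Fin ℓ → Fin k) (r : ℕ) [Fintype (State v r)] (n : ℕ) :
    g v r n = ∑ t : State v r, wordCount v r n t := by
  classical
  rw [g, ← Finset.sum_fiberwise_of_maps_to (t := Finset.range (r + 1))
    (g := fun t : State v r => profile v r t.1 [])]
  · exact Finset.sum_congr rfl fun j hj => f_eq_sum (Nat.lt_succ_iff.1 (Finset.mem_range.1 hj)) n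
  · intro t _
    obtain ⟨w, hw, rfl⟩ := exists_eq_stateOf t
    rw [Finset.mem_range]
    change min (r + 1) (occ v (w ++ [])) < r + 1
    rw [List.append_nil]
    omega

end PatternWords

/-! ### The dominant degree and the two limits -/

open PatternWords Filter Topology

theorem mainTheorem2 {k ℓ : ℕ} (v : Fin ℓ → Fin k) (hd : 1 < PatternWords.numLetters v) (r : ℕ) :
    ∃ M : ℕ, 1 ≤ M ∧
      IsGreatest {c : ℕ | ∃ p : List (PatternWords.State v r),
        PatternWords.IsSimplePath v r p ∧ c = PatternWords.numFullStates v r p} (M + 1) ∧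
      ∃ C K : ℝ, 0 < C ∧ 0 ≤ K ∧
        Filter.Tendsto (fun n : ℕ => (PatternWords.g v r n : ℝ) /
            ((n : ℝ) ^ M * ((PatternWords.numLetters v : ℝ) - 1) ^ n))
          Filter.atTop (nhds C) ∧
        Filter.Tendsto (fun n : ℕ => (PatternWords.f v r n : ℝ) /
            ((n : ℝ) ^ M * ((PatternWords.numLetters v : ℝ) - 1) ^ n))
          Filter.atTop (nhds K) := by
  classical
  have hℓ := length_pos_of_numLetters_pos (zero_lt_one.trans hd)
  have h0 : occ v [] ≤ r := (occ_nil hℓ).trans_le (Nat.zero_le r)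
  have : Fintype (State v r) := Fintype.ofFinite _
  let _ : PartialOrder (State v r) := PartialOrder.lift (fun s => profile v r s.1)
    ((profile_injective v r).comp Subtype.val_injective)
  obtain ⟨D, hD⟩ : ∃ D, numLetters v = D + 1 := ⟨numLetters v - 1, by omega⟩
  have hD' : numLetters v - 1 = D := by omega
  choose m hm hgrow using exists_isGreatest_pathCount_growth (e := edgeCount v r)
    (D := numLetters v - 1) (s₀ := stateOf v h0) (N := wordCount v r) (by omega)
    (fun s t h => profile_le_of_edge (edgeCount_ne_zero_iff.1 h))
    (fun t => Nat.le_sub_one_of_lt (numLoops_lt_numLetters hℓ t))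
    (eq_start_of_wordCount_zero_ne_zero h0) wordCount_succ exists_wordCount_ne_zero
  obtain ⟨t₂, c₂, hc₂, ht₂⟩ := exists_pathCount_two_le hd h0
  obtain ⟨T, -, hT⟩ := Finset.exists_max_image Finset.univ m ⟨t₂, Finset.mem_univ _⟩
  have hT2 : 2 ≤ m T := hc₂.trans (((hm t₂).2 ht₂).trans (hT t₂ (Finset.mem_univ _)))
  obtain ⟨M, hM⟩ : ∃ M, m T = M + 1 := ⟨m T - 1, by omega⟩
  refine ⟨M, by omega, ⟨?_, ?_⟩, ?_⟩
  · obtain ⟨p, hp, hc, -⟩ := (hm T).1.exists_isSimplePath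
    exact ⟨_, hp, by rw [hc, hM]⟩
  · rintro c ⟨p, hp, rfl⟩
    rcases List.eq_nil_or_concat p with rfl | ⟨q, t, hq⟩
    · exact Nat.zero_le _
    · rw [List.concat_eq_append] at hq
      subst hq
      rw [← hM]
      exact ((hm t).2 (PathCount.of_isSimplePath h0 q t hp)).trans (hT t (Finset.mem_univ _))
  -- All states are normalised by the same `n ^ M`; those of lower degree have limit 0, and `T` has
  -- a positive one.
  · choose c hc0 hcpos hct using fun t =>
      (hgrow t).exists_tendsto ((hT t (Finset.mem_univ _)).trans_eq hM)
    have hsum : ∀ s : Finset (State v r), Tendsto (fun n : ℕ =>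
        ((∑ t ∈ s, wordCount v r n t : ℕ) : ℝ) / ((n : ℝ) ^ M * ((numLetters v : ℝ) - 1) ^ n))
        atTop (𝓝 (∑ t ∈ s, c t)) := by
      intro s
      refine (tendsto_finsetSum s fun t _ => hct t).congr fun n => ?_
      rw [Nat.cast_sum, Finset.sum_div]
      refine Finset.sum_congr rfl fun t _ => ?_
      rw [div_div, mul_comm, hD', hD, Nat.cast_succ, add_sub_cancel_right]
    -- The constant `K` collects only the states with exactly `r` occurrences; `T` need not be among
    -- them, so positivity is not claimed.
    refine ⟨∑ t, c t, ∑ t with profile v r t.1 [] = r, c t,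
      Finset.sum_pos' (fun t _ => hc0 t) ⟨T, Finset.mem_univ _, hcpos T hM⟩,
      Finset.sum_nonneg fun t _ => hc0 t, ?_, ?_⟩
    · exact (hsum Finset.univ).congr fun n => by rw [g_eq_sum]
    · exact (hsum _).congr fun n => by rw [f_eq_sum le_rfl]
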